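/- **Theorem 4.12.** Let $X$ be a Hausdorff topological space that is locally homeomorphic to rotund vector spaces: every point of $X$ has an open neighbourhood homeomorphic to an open subset of some rotund vector space (which may depend on the point). Here a topological real vector space $V$ is *rotund* if its topology is induced by a norm such that $\|x\|=\|y\|=\left\|\frac{x+y}{2}\right\|$ holds only when $x=y$. Let $\mathrm{Exp}_M(X)$ be the set of all finite subsets $S\subseteq X$ (including $\varnothing$), with the coarsest topology in which, for every finite family $(U_i)_{i\in I}$ of open subsets of $X$, the set $$[U_i]_{i\in I}=\Bigl\{S : S\subseteq \bigcup_{i\in I}U_i \text{ and } S\cap U_i\neq\varnothing \text{ for all } i\in I\Bigr\}$$ is open. Let $\omega_*=\{0\}\sqcup\{1<2<3<\cdots\}$ be the poset in which $0$ is comparable only to itself. Then $\mathrm{Exp}_M(X)$, with the map $\mathrm{Exp}_M(X)\to\omega_*$, $S\mapsto |S|$, is conically stratified. The terms mean the following. * A *stratified space* over a poset $P$ is a topological space $Y$ with a map $f:Y\to P$ that is continuous for the topology on $P$ whose open sets are the upward closed subsets. Put $Y_p=f^{-1}(p)$, $P_{p<}=\{q\in P: p<q\}$ and $P_{p\leq}=\{q\in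 P: p\le q\}$. * The *open cone* $C(L)$ of a topological space $L$ is the set $\{0\}\sqcup\bigl((0,\infty)\times L\bigr)$, in which $W$ is open if and only if $W\cap\bigl((0,\infty)\times L\bigr)$ is open in the product topology and, when $0\in W$, one has $(0,\varepsilon)\times L\subseteq W$ for some $\varepsilon>0$. If $L$ is stratified by $g:L\to P_{p<}$, then $C(L)$ is stratified over $P_{p\leq}$ by $0\mapsto p$ and $(t,y)\mapsto g(y)$. * A map $f:Y\to P$ from a topological space to a poset makes $Y$ *conically stratified* if $f$ is a stratification and, for every $p\in P$ and $x\in Y_p$, there exist an open neighbourhood $U$ of $x$ in $Y_p$, a stratified space $L$ over $P_{p<}$, and an open embedding $e:U\times C(L)\to Y$ such that $e(u,0)=u$ for all $u\in U$, and $f(e(u,c))$ is the stratum of $c$ in $P_{p\leq}$ for all $(u,c)\in U\times C(L)$. -/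

import Mathlib

universe u v

/-! ### Stratified spaces and open cones -/

/-- A stratification of a topological space `X` over a poset `P` is a map `f : X → P` which is
continuous for the topology on `P` whose open sets are the upward closed subsets. -/
def IsStratification {X : Type*} [TopologicalSpace X] {P : Type*} [PartialOrder P]
    (f : X → P) : Prop :=
  Continuous fun x => Topology.WithUpperSet.toUpperSet (f x)

/-- The underlying set of the open cone: a tip together with `(0, ∞) × L`. -/
inductive OpenCone (L : Type u) : Type u
  | tip : OpenCone L
  | ray (t : Set.Ioi (0 : ℝ)) (y : L) : OpenCone L

/-- A subset `W` of the open cone is open when its trace on `(0, ∞) × L` is open and, if it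
contains the tip, it also contains `(0, ε) × L` for some `ε > 0`. -/
instance OpenCone.instTopologicalSpace {L : Type u} [TopologicalSpace L] :
    TopologicalSpace (OpenCone L) where
  IsOpen W :=
    IsOpen {z : Set.Ioi (0 : ℝ) × L | OpenCone.ray z.1 z.2 ∈ W} ∧
      (OpenCone.tip ∈ W →
        ∃ ε : ℝ, 0 < ε ∧ ∀ (t : Set.Ioi (0 : ℝ)) (y : L), (t : ℝ) < ε → OpenCone.ray t y ∈ W)
  isOpen_univ := ⟨by simp, fun _ => ⟨1, one_pos, fun _ _ _ => Set.mem_univ _⟩⟩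
  isOpen_inter := by
    rintro W W' ⟨h₁, h₂⟩ ⟨h₁', h₂'⟩
    refine ⟨h₁.inter h₁', fun h => ?_⟩
    obtain ⟨ε, hε, H⟩ := h₂ h.1
    obtain ⟨ε', hε', H'⟩ := h₂' h.2
    exact ⟨min ε ε', lt_min hε hε', fun t y ht =>
      ⟨H t y (ht.trans_le (min_le_left _ _)), H' t y (ht.trans_le (min_le_right _ _))⟩⟩
  isOpen_sUnion := by
    intro 𝒲 h
    refine ⟨?_, ?_⟩
    · have : {z : Set.Ioi (0 : ℝ) × L | OpenCone.ray z.1 z.2 ∈ ⋃₀ 𝒲} =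
          ⋃ W ∈ 𝒲, {z : Set.Ioi (0 : ℝ) × L | OpenCone.ray z.1 z.2 ∈ W} := by
        ext z
        simp
      rw [this]
      exact isOpen_biUnion fun W hW => (h W hW).1
    · rintro ⟨W, hW, htip⟩
      obtain ⟨ε, hε, H⟩ := (h W hW).2 htip
      exact ⟨ε, hε, fun t y ht => ⟨W, hW, H t y ht⟩⟩

/-- If `L` is stratified over `P_{p<}` by `g`, its open cone is stratified over `P_{p<}` with a
smallest element added, that is, over `P_{p≤}`: the tip lies over `p` and `(t, y)` over `g y`.
The values are viewed in `P`. -/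
def OpenCone.strat {P : Type*} [PartialOrder P] (p : P) {L : Type*} (g : L → Set.Ioi p) :
    OpenCone L → P
  | .tip => p
  | .ray _ y => g y

/-- `X`, with `f : X → P`, is conically stratified: `f` is a stratification, and for every point
`x`, lying over `p` say, there are an open neighbourhood `U` of `x` in the stratum `X_p` and a
space `L` stratified over `P_{p<}` such that the inclusion of `U` extends to an open embedding
`U × C(L) → X` of stratified spaces over `P_{p≤} ⊆ P`. -/
structure IsConicallyStratified {X : Type u} [TopologicalSpace X] {P : Type*} [PartialOrder P]
    (f : X → P) : Prop where
  isStratification : IsStratification f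
  exists_chart : ∀ (p : P) (x : {y : X // f y = p}),
    ∃ (U : Set {y : X // f y = p}) (L : Type u) (_ : TopologicalSpace L) (g : L → Set.Ioi p)
      (e : U × OpenCone L → X),
      IsOpen U ∧ x ∈ U ∧ IsStratification g ∧ Topology.IsOpenEmbedding e ∧
        (∀ u : U, e (u, OpenCone.tip) = u.1.1) ∧
        (∀ z : U × OpenCone L, f (e z) = OpenCone.strat p g z.2)

/-! ### The metric exponential and its stratification by cardinality -/

/-- The poset `{0} ⊔ {1 < 2 < 3 < ⋯}`, in which `0` is comparable only to itself. -/
structure OmegaStar : Type where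
  val : ℕ

instance : PartialOrder OmegaStar where
  le a b := a = b ∨ (0 < a.val ∧ a.val ≤ b.val)
  le_refl _ := Or.inl rfl
  le_trans := by
    rintro ⟨a⟩ ⟨b⟩ ⟨c⟩ h h'
    simp only [OmegaStar.mk.injEq] at h h' ⊢
    omega
  le_antisymm := by
    rintro ⟨a⟩ ⟨b⟩ h h'
    simp only [OmegaStar.mk.injEq] at h h' ⊢
    omega

/-- The points of the metric exponential of `X`: the finite subsets of `X`, including `∅`. -/
def MetricExp (X : Type u) : Type u := Finset X

namespace MetricExp

/-- The finite subset `S`, viewed as a set. -/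
def toSet {X : Type u} : MetricExp X → Set X :=
  fun S : Finset X => (S : Set X)

/-- For a family `𝒰` of subsets of `X`, the set of all finite `S ⊆ X` which are contained in the
union of the family and meet each of its members. -/
def basicSet {X : Type u} (𝒰 : Set (Set X)) : Set (MetricExp X) :=
  {S : MetricExp X | S.toSet ⊆ ⋃₀ 𝒰 ∧ ∀ U ∈ 𝒰, (S.toSet ∩ U).Nonempty}

/-- The coarsest topology for which `basicSet 𝒰` is open for every finite family `𝒰` of open
subsets of `X`. -/
instance {X : Type u} [TopologicalSpace X] : TopologicalSpace (MetricExp X) :=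
  TopologicalSpace.generateFrom
    {B | ∃ 𝒰 : Set (Set X), 𝒰.Finite ∧ (∀ U ∈ 𝒰, IsOpen U) ∧ B = basicSet 𝒰}

/-- The counting map sending a finite subset to its cardinality. -/
def count {X : Type u} (S : MetricExp X) : OmegaStar := ⟨Finset.card (S : Finset X)⟩

end MetricExp

/-! ### Spaces locally homeomorphic to rotund vector spaces -/

/-- A topological (real) vector space is rotund when its topology is induced by a norm `N` such
that `N x = N y = N ((x + y) / 2)` only when `x = y`. -/
def IsRotund (V : Type v) [AddCommGroup V] [Module ℝ V] [TopologicalSpace V] : Prop :=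
  ∃ N : Seminorm ℝ V,
    (∀ x : V, N x = 0 → x = 0) ∧
    (∀ W : Set V, IsOpen W ↔ ∀ x ∈ W, ∃ ε : ℝ, 0 < ε ∧ ∀ y : V, N (y - x) < ε → y ∈ W) ∧
    (∀ x y : V, N x = N y → N y = N ((2⁻¹ : ℝ) • (x + y)) → x = y)

/-- Every point of `X` has an open neighbourhood homeomorphic to an open subset of a rotund
vector space. The vector space is allowed to depend on the point. -/
def IsLocallyRotund (X : Type u) [TopologicalSpace X] : Prop :=
  ∀ x : X, ∃ (V : Type v) (_ : AddCommGroup V) (_ : Module ℝ V) (_ : TopologicalSpace V)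
    (e : OpenPartialHomeomorph X V), IsRotund V ∧ x ∈ e.source

/-!
Near a point `{x₁, …, xₙ}` of the metric exponential, a finite subset `T` of `X` is a disjoint
union of nonempty finite subsets `Tᵢ` of charts around the `xᵢ`. A ball in a normed space is
homeomorphic to the whole space, so the charts can be taken to be all of strictly convex normed
spaces `Vᵢ`, and together they give an open embedding `j` of `Σ i, Vᵢ` into `X`
(`IsLocallyRotund.exists_isOpenEmbedding_sigma`). Since `MetricExp.map j` is again an open embedding
(`MetricExp.isOpenEmbedding_map`), it is enough to find the conical structure on the open set of
*full* finite subsets of `Σ i, Vᵢ`, those meeting every `Vᵢ`.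

The geometric input is a continuous choice of a centre of a finite set that commutes with
translations and scalings. The barycentre does not work, as it jumps when points collide. The
Chebyshev centre relative to the convex hull does: a minimiser on the hull of the largest distance
to the points of the set exists because the hull of a finite set is compact, without any
completeness, it is unique by strict convexity (`MetricExp.IsCenter.unique`), and it depends
continuously on the set for the same two reasons (`MetricExp.continuousAt_center`).

A full `T` thus has centres `c ∈ ∏ Vᵢ` and a radius `r ≥ 0`, the largest distance from a point to
the centre of its part. If `r = 0`, then `T` has one point in each component and lies in the stratum
of `{x₁, …, xₙ}`. If `r > 0`, then `T` has more points than that, and it is obtained by scaling by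
`r` and translating by `c` from a unique full set with centres `0` and radius `1`. The sets of the
latter kind form the link `L`, and `T ↦ (c, r, T normalised)` is a homeomorphism from the full
subsets to `∏ Vᵢ × C(L)` (`MetricExp.isOpenEmbedding_spread` is its inverse). At the tip, the cone
topology is the one determined by the radial coordinate alone (`OpenCone.tendsto_nhds_tip`), and
this matches the bound of the distance from `T` to its centres by `r`.
-/

open Filter Topology

/-! ### Stratifications as lower semicontinuous maps -/

theorem isStratification_iff_eventually_le {X : Type*} [TopologicalSpace X] {P : Type*}
    [PartialOrder P] {f : X → P} : IsStratification f ↔ ∀ x, ∀ᶠ y in 𝓝 x, f x ≤ f y := by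
  refine continuous_iff_continuousAt.trans (forall_congr' fun x => ?_)
  rw [ContinuousAt, Topology.IsUpperSet.nhds_eq_principal_Ici (α := Topology.WithUpperSet P),
    tendsto_principal]
  rfl

namespace MetricExp

universe w
variable {X : Type u} {Y : Type v}

/-! ### The metric exponential and the Vietoris topology -/

theorem toSet_injective : Function.Injective (toSet : MetricExp X → Set X) :=
  fun _ _ h => Finset.coe_injective h

theorem finite_toSet (S : MetricExp X) : S.toSet.Finite :=
  Finset.finite_toSet _

/-- The point of the metric exponential given by a finite set. -/
noncomputable def ofSet (s : Set X) (hs : s.Finite) : MetricExp X :=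
  hs.toFinset

@[simp]
theorem toSet_ofSet (s : Set X) (hs : s.Finite) : (ofSet s hs).toSet = s :=
  hs.coe_toFinset

theorem count_eq_ncard (S : MetricExp X) : S.count = ⟨S.toSet.ncard⟩ :=
  congrArg OmegaStar.mk (Set.ncard_coe_finset _).symm

/-- The image of a finite subset under a map. -/
noncomputable def map (f : X → Y) (S : MetricExp X) : MetricExp Y :=
  ofSet (f '' S.toSet) (S.finite_toSet.image f)

@[simp]
theorem toSet_map (f : X → Y) (S : MetricExp X) : (S.map f).toSet = f '' S.toSet :=
  toSet_ofSet _ _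

theorem map_map {Z : Type w} (g : Y → Z) (f : X → Y) (S : MetricExp X) :
    (S.map f).map g = S.map (fun x => g (f x)) :=
  toSet_injective (by simp [Set.image_image])

theorem count_map {f : X → Y} (hf : Function.Injective f) (S : MetricExp X) :
    (S.map f).count = S.count := by
  simp [count_eq_ncard, Set.ncard_image_of_injective _ hf]

theorem map_injective {f : X → Y} (hf : Function.Injective f) :
    Function.Injective (map f) := fun S T h =>
  toSet_injective <| hf.image_injective <| by simpa using congrArg toSet h

/-- The inverse image of a finite subset under an injective map. -/
noncomputable def comap (f : X → Y) (hf : Function.Injective f) (S : MetricExp Y) : MetricExp X :=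
  ofSet (f ⁻¹' S.toSet) (S.finite_toSet.preimage hf.injOn)

@[simp]
theorem toSet_comap (f : X → Y) (hf : Function.Injective f) (S : MetricExp Y) :
    (S.comap f hf).toSet = f ⁻¹' S.toSet :=
  toSet_ofSet _ _

theorem range_map {f : X → Y} (hf : Function.Injective f) :
    Set.range (map f) = {S : MetricExp Y | S.toSet ⊆ Set.range f} := by
  ext S
  constructor
  · rintro ⟨T, rfl⟩
    simp
  · intro h
    exact ⟨S.comap f hf, toSet_injective (by simpa using Set.image_preimage_eq_of_subset h)⟩

variable [TopologicalSpace X] [TopologicalSpace Y]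

theorem isOpen_basicSet {𝒰 : Set (Set X)} (h : 𝒰.Finite) (h' : ∀ U ∈ 𝒰, IsOpen U) :
    IsOpen (basicSet 𝒰) :=
  TopologicalSpace.isOpen_generateFrom_of_mem ⟨𝒰, h, h', rfl⟩

theorem isOpen_setOf_toSet_subset {O : Set X} (hO : IsOpen O) :
    IsOpen {S : MetricExp X | S.toSet ⊆ O} := by
  have : {S : MetricExp X | S.toSet ⊆ O} = basicSet ∅ ∪ basicSet {O} := by
    ext S
    rcases S.toSet.eq_empty_or_nonempty with h | h
    · simp [basicSet, h]
    · simp only [basicSet, Set.mem_ofPred_eq, Set.sUnion_empty, Set.subset_empty_iff, h.ne_empty,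
        Set.mem_union, false_and, false_or, Set.sUnion_singleton, Set.mem_singleton_iff,
        forall_eq]
      exact ⟨fun hS => ⟨hS, by rwa [Set.inter_eq_left.2 hS]⟩, fun hS => hS.1⟩
  rw [this]
  exact (isOpen_basicSet Set.finite_empty (by simp)).union
    (isOpen_basicSet (Set.finite_singleton _) (by simpa))

theorem isOpen_setOf_toSet_inter_nonempty {O : Set X} (hO : IsOpen O) :
    IsOpen {S : MetricExp X | (S.toSet ∩ O).Nonempty} := by
  have : {S : MetricExp X | (S.toSet ∩ O).Nonempty} = basicSet {O, Set.univ} := by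
    ext S
    simp only [basicSet, Set.mem_ofPred_eq, Set.sUnion_insert, Set.sUnion_singleton,
      Set.union_univ, Set.subset_univ, true_and, Set.mem_insert_iff, Set.mem_singleton_iff,
      forall_eq_or_imp, forall_eq, Set.inter_univ]
    exact ⟨fun h => ⟨h, h.mono Set.inter_subset_left⟩, fun h => h.1⟩
  rw [this]
  exact isOpen_basicSet (by simp) (by simp [hO])

/-- The topology of the metric exponential is the Vietoris topology, generated by the conditions
of being contained in an open set and of meeting an open set. -/
theorem tendsto_nhds_iff {α : Type*} {l : Filter α} {F : α → MetricExp X} {S : MetricExp X} :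
    Tendsto F l (𝓝 S) ↔ ∀ O : Set X, IsOpen O →
      (S.toSet ⊆ O → ∀ᶠ a in l, (F a).toSet ⊆ O) ∧
      ((S.toSet ∩ O).Nonempty → ∀ᶠ a in l, ((F a).toSet ∩ O).Nonempty) := by
  constructor
  · intro h O hO
    exact ⟨fun hS => h.eventually ((isOpen_setOf_toSet_subset hO).mem_nhds hS),
      fun hS => h.eventually ((isOpen_setOf_toSet_inter_nonempty hO).mem_nhds hS)⟩
  · intro h
    rw [TopologicalSpace.tendsto_nhds_generateFrom_iff]
    rintro _ ⟨𝒰, hfin, hopen, rfl⟩ ⟨h₁, h₂⟩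
    have e₁ := (h _ (isOpen_sUnion hopen)).1 h₁
    have e₂ : ∀ᶠ a in l, ∀ U ∈ 𝒰, ((F a).toSet ∩ U).Nonempty :=
      (eventually_all_finite hfin).2 fun U hU => (h U (hopen U hU)).2 (h₂ U hU)
    filter_upwards [e₁, e₂] with a ha₁ ha₂ using ⟨ha₁, ha₂⟩

/-- The image of a finite subset depends jointly continuously on the map and on the subset. -/
theorem tendsto_map {α A : Type*} [TopologicalSpace A] {f : A → X → Y}
    (hf : Continuous fun z : A × X => f z.1 z.2) {l : Filter α} {a : α → A} {a₀ : A}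
    (ha : Tendsto a l (𝓝 a₀)) {F : α → MetricExp X} {S : MetricExp X}
    (hF : Tendsto F l (𝓝 S)) : Tendsto (fun i => (F i).map (f (a i))) l (𝓝 (S.map (f a₀))) := by
  rw [tendsto_nhds_iff] at hF ⊢
  intro O hO
  have hO' := hO.preimage hf
  constructor
  · intro hS
    obtain ⟨A', X', hA', hX', h₁, h₂, h₃⟩ := generalized_tube_lemma (isCompact_singleton (x := a₀))
      S.finite_toSet.isCompact hO' (by
        rintro ⟨b, x⟩ ⟨hb, hx⟩
        obtain rfl : b = a₀ := hb
        exact hS (by simpa using ⟨x, hx, rfl⟩))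
    filter_upwards [(hF X' hX').1 h₂, ha (hA'.mem_nhds (h₁ rfl))] with i hi hi'
    rw [toSet_map]
    rintro _ ⟨x, hx, rfl⟩
    exact h₃ (Set.mk_mem_prod hi' (hi hx))
  · rintro ⟨y, hy, hyO⟩
    rw [toSet_map] at hy
    obtain ⟨x, hx, rfl⟩ := hy
    obtain ⟨A', X', hA', hX', h₁, h₂, h₃⟩ := isOpen_prod_iff.1 hO' a₀ x hyO
    filter_upwards [(hF X' hX').2 ⟨x, hx, h₂⟩, ha (hA'.mem_nhds h₁)] with i ⟨x', hx', hxX⟩ hi'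
    exact ⟨f (a i) x', by simpa using ⟨x', hx', rfl⟩, h₃ (Set.mk_mem_prod hi' hxX)⟩

theorem isOpenEmbedding_map {f : X → Y} (hf : IsOpenEmbedding f) : IsOpenEmbedding (map f) where
  injective := map_injective hf.injective
  isOpen_range := by
    rw [range_map hf.injective]
    exact isOpen_setOf_toSet_subset hf.isOpen_range
  eq_induced := by
    suffices h : IsInducing (map f) from h.eq_induced
    refine isInducing_iff_nhds.2 fun S => le_antisymm ?_ ?_
    · have h : Continuous fun z : Unit × X => f z.2 := hf.continuous.comp continuous_snd
      exact tendsto_iff_comap.1 (tendsto_map (f := fun _ : Unit => f) h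
        (tendsto_const_nhds (x := ())) (tendsto_id (x := 𝓝 S)))
    · refine tendsto_id'.1 (tendsto_nhds_iff.2 fun O hO => ?_)
      have h := (tendsto_nhds_iff.1 (tendsto_comap (f := map f) (x := 𝓝 (S.map f))))
        (f '' O) (hf.isOpenMap O hO)
      simpa [Set.image_subset_image_iff hf.injective, ← Set.image_inter hf.injective] using h

theorem continuous_comap {f : X → Y} (ho : IsOpenEmbedding f) (hc : IsClosedEmbedding f) :
    Continuous (comap f ho.injective) := by
  refine continuous_iff_continuousAt.2 fun S => tendsto_nhds_iff.2 fun O hO => ?_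
  simp only [toSet_comap]
  constructor
  · intro hS
    have hO' : IsOpen (f '' Oᶜ)ᶜ := (hc.isClosedMap _ hO.isClosed_compl).isOpen_compl
    have key : ∀ T : MetricExp Y, f ⁻¹' T.toSet ⊆ O ↔ T.toSet ⊆ (f '' Oᶜ)ᶜ := fun T => by
      constructor
      · rintro h _ hy ⟨x, hx, rfl⟩
        exact hx (h hy)
      · intro h x hx
        by_contra hxO
        exact h hx ⟨x, hxO, rfl⟩
    simp only [key] at hS ⊢
    exact (isOpen_setOf_toSet_subset hO').mem_nhds hS
  · have key : ∀ T : MetricExp Y, (f ⁻¹' T.toSet ∩ O).Nonempty ↔ (T.toSet ∩ f '' O).Nonempty :=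
      fun T => by
        rw [Set.inter_comm (T.toSet), Set.inter_comm (f ⁻¹' _), ← Set.image_inter_preimage,
          Set.image_nonempty]
    simp only [key]
    exact fun hS => (isOpen_setOf_toSet_inter_nonempty (ho.isOpenMap _ hO)).mem_nhds hS

/-! ### Semicontinuity of the cardinality -/

theorem eventually_count_le [T2Space X] (S : MetricExp X) :
    ∀ᶠ T in 𝓝 S, S.count ≤ T.count := by
  rcases S.toSet.eq_empty_or_nonempty with h | h
  · filter_upwards [(isOpen_setOf_toSet_subset isOpen_empty).mem_nhds h.subset] with T hT
    have : S = T := toSet_injective (by rw [h, Set.subset_eq_empty hT rfl])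
    exact this ▸ le_rfl
  · obtain ⟨U, hU, hdisj⟩ := S.finite_toSet.t2_separation
    have : ∀ᶠ T : MetricExp X in 𝓝 S, ∀ x ∈ S.toSet, (T.toSet ∩ U x).Nonempty :=
      (eventually_all_finite S.finite_toSet).2 fun x hx =>
        (isOpen_setOf_toSet_inter_nonempty (hU x).2).mem_nhds ⟨x, hx, (hU x).1⟩
    filter_upwards [this] with T hT
    choose! g hg hgU using hT
    rw [count_eq_ncard, count_eq_ncard]
    refine Or.inr ⟨(Set.ncard_pos S.finite_toSet).2 h, ?_⟩
    refine Set.ncard_le_ncard_of_injOn g hg (fun x hx y hy hxy => ?_) T.finite_toSet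
    by_contra hne
    exact Set.disjoint_left.1 (hdisj hx hy hne) (hgU x hx) (hxy ▸ hgU y hy)

end MetricExp

/-! ### Chebyshev centres of finite sets -/

namespace MetricExp

open Metric
open scoped NNReal

section PseudoMetric

variable {V : Type*} [PseudoMetricSpace V]

/-- The least radius of a closed ball with the given centre that contains the finite set `T`. -/
noncomputable def outerRadius (T : MetricExp V) (x : V) : ℝ≥0 :=
  Finset.sup (show Finset V from T) fun t => nndist x t

theorem outerRadius_le_iff {T : MetricExp V} {x : V} {a : ℝ≥0} :
    T.outerRadius x ≤ a ↔ ∀ t ∈ T.toSet, nndist x t ≤ a :=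
  Finset.sup_le_iff

theorem nndist_le_outerRadius {T : MetricExp V} {t : V} (ht : t ∈ T.toSet) (x : V) :
    nndist x t ≤ T.outerRadius x :=
  outerRadius_le_iff.1 le_rfl t ht

theorem outerRadius_le_add_nndist (T : MetricExp V) (x y : V) :
    T.outerRadius x ≤ T.outerRadius y + nndist x y :=
  outerRadius_le_iff.2 fun t ht => (nndist_triangle x y t).trans <| by
    rw [add_comm]
    gcongr
    exact nndist_le_outerRadius ht y

theorem outerRadius_le_add_of_subset_thickening {T T' : MetricExp V} {δ : ℝ≥0}
    (h : T.toSet ⊆ thickening δ T'.toSet) (x : V) :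
    T.outerRadius x ≤ T'.outerRadius x + δ := by
  refine outerRadius_le_iff.2 fun t ht => ?_
  obtain ⟨t', ht', htt⟩ := mem_thickening_iff.1 (h ht)
  refine (nndist_triangle_right x t t').trans (add_le_add (nndist_le_outerRadius ht' x) ?_)
  exact_mod_cast htt.le

theorem eventually_subset_thickening (T : MetricExp V) {δ : ℝ} (hδ : 0 < δ) :
    ∀ᶠ T' in 𝓝 T, T'.toSet ⊆ thickening δ T.toSet ∧ T.toSet ⊆ thickening δ T'.toSet := by
  have h : ∀ᶠ T' : MetricExp V in 𝓝 T, T'.toSet ⊆ thickening δ T.toSet :=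
    (isOpen_setOf_toSet_subset isOpen_thickening).mem_nhds (self_subset_thickening hδ T.toSet)
  refine h.and ?_
  refine (eventually_all_finite T.finite_toSet).2 fun t ht => ?_
  filter_upwards [(isOpen_setOf_toSet_inter_nonempty (isOpen_ball (x := t) (ε := δ))).mem_nhds
    ⟨t, ht, mem_ball_self hδ⟩] with T' ⟨t', ht', h⟩
  exact mem_thickening_iff.2 ⟨t', ht', mem_ball'.1 h⟩

theorem continuous_outerRadius :
    Continuous fun z : MetricExp V × V => z.1.outerRadius z.2 := by
  rw [continuous_iff_continuousAt]
  rintro ⟨T, x⟩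
  refine Metric.tendsto_nhds.2 fun ε hε => ?_
  lift ε to ℝ≥0 using hε.le
  have h := (T.eventually_subset_thickening (δ := (ε / 2 : ℝ≥0)) (by simpa using hε)).prod_nhds
    (ball_mem_nhds x (ε := (ε / 2 : ℝ≥0)) (by simpa using hε))
  filter_upwards [h] with ⟨T', y⟩ ⟨⟨h₁, h₂⟩, h₃⟩
  have e₁ := outerRadius_le_add_of_subset_thickening h₁ x
  have e₂ := outerRadius_le_add_of_subset_thickening h₂ x
  have e₃ := T'.outerRadius_le_add_nndist x y
  have e₄ := T'.outerRadius_le_add_nndist y x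
  have e₅ : dist y x < (ε / 2 : ℝ≥0) := h₃
  rw [nndist_comm] at e₃
  rw [NNReal.dist_eq, abs_sub_lt_iff]
  simp only [← NNReal.coe_le_coe, NNReal.coe_add, coe_nndist, NNReal.coe_div,
    NNReal.coe_ofNat] at *
  constructor <;> linarith

theorem continuous_outerRadius_left (T : MetricExp V) : Continuous T.outerRadius :=
  continuous_outerRadius.comp (by fun_prop : Continuous fun x : V => (T, x))

end PseudoMetric

variable {V : Type*} [NormedAddCommGroup V] [NormedSpace ℝ V]

/-- `x` is a Chebyshev centre of `T` relative to the convex hull of `T`: among the points of the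
convex hull it minimises the largest distance to a point of `T`. -/
def IsCenter (T : MetricExp V) (x : V) : Prop :=
  x ∈ convexHull ℝ T.toSet ∧ ∀ y ∈ convexHull ℝ T.toSet, T.outerRadius x ≤ T.outerRadius y

theorem exists_isCenter {T : MetricExp V} (hT : T.toSet.Nonempty) : ∃ x, T.IsCenter x :=
  (T.finite_toSet.isCompact_convexHull ℝ).exists_isMinOn hT.convexHull
    (f := T.outerRadius) T.continuous_outerRadius_left.continuousOn

/-- Among two distinct points, one is farther from some point of `T` than the midpoint is from
all of `T`; this is where strict convexity of the norm is used. -/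
theorem IsCenter.unique [StrictConvexSpace ℝ V] {T : MetricExp V} {x y : V} (hx : T.IsCenter x)
    (hy : T.IsCenter y) : x = y := by
  by_contra hne
  have hxy : T.outerRadius y = T.outerRadius x := le_antisymm (hy.2 x hx.1) (hx.2 y hy.1)
  have hT : T.toSet.Nonempty := convexHull_nonempty_iff.1 ⟨x, hx.1⟩
  have hmem : (1 / 2 : ℝ) • x + (1 / 2 : ℝ) • y ∈ convexHull ℝ T.toSet :=
    convex_convexHull ℝ _ hx.1 hy.1 (by norm_num) (by norm_num) (by norm_num)
  refine (hx.2 _ hmem).not_gt ?_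
  obtain ⟨t, ht, hmax⟩ := Finset.exists_mem_eq_sup (show Finset V from T) hT
    fun t => nndist ((1 / 2 : ℝ) • x + (1 / 2 : ℝ) • y) t
  refine hmax.trans_lt ?_
  have h₁ : x ∈ closedBall t (T.outerRadius x) := nndist_le_outerRadius ht x
  have h₂ : y ∈ closedBall t (T.outerRadius x) := hxy ▸ nndist_le_outerRadius ht y
  exact combo_mem_ball_of_ne h₁ h₂ hne (by norm_num) (by norm_num) (by norm_num)

open Classical in
/-- The Chebyshev centre of a nonempty finite set relative to its convex hull, with the value `0`
at the empty set. -/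
noncomputable def center (T : MetricExp V) : V :=
  if h : T.toSet.Nonempty then (exists_isCenter h).choose else 0

theorem isCenter_center {T : MetricExp V} (hT : T.toSet.Nonempty) : T.IsCenter T.center := by
  rw [center, dif_pos hT]
  exact (exists_isCenter hT).choose_spec

theorem outerRadius_map_add_smul (T : MetricExp V) (a x : V) (t : ℝ) :
    (T.map fun v => a + t • v).outerRadius (a + t • x) = ‖t‖₊ * T.outerRadius x := by
  have h : ∀ v, nndist (a + t • x) (a + t • v) = ‖t‖₊ * nndist x v := fun v => by
    rw [nndist_add_left, nndist_smul₀]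
  refine le_antisymm (outerRadius_le_iff.2 ?_) ?_
  · rw [toSet_map]
    rintro _ ⟨v, hv, rfl⟩
    rw [h]
    gcongr
    exact nndist_le_outerRadius hv x
  · rw [outerRadius, NNReal.mul_finset_sup]
    refine Finset.sup_le fun v hv => (h v).symm.trans_le (nndist_le_outerRadius ?_ _)
    rw [toSet_map]
    exact ⟨v, hv, rfl⟩

variable [StrictConvexSpace ℝ V]

theorem IsCenter.center_eq {T : MetricExp V} {x : V} (h : T.IsCenter x) : T.center = x :=
  (isCenter_center (convexHull_nonempty_iff.1 ⟨x, h.1⟩)).unique h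

theorem center_map_add_smul {T : MetricExp V} (hT : T.toSet.Nonempty) (a : V) (t : ℝ) :
    (T.map fun v => a + t • v).center = a + t • T.center := by
  obtain ⟨h₁, h₂⟩ := isCenter_center hT
  have key : convexHull ℝ (T.map fun v => a + t • v).toSet =
      (fun v => a + t • v) '' convexHull ℝ T.toSet := by
    rw [toSet_map]
    exact ((AffineMap.const ℝ V a + t • AffineMap.id ℝ V).image_convexHull T.toSet).symm
  refine IsCenter.center_eq ⟨key ▸ ⟨_, h₁, rfl⟩, ?_⟩
  rw [key]
  rintro _ ⟨y, hy, rfl⟩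
  simp only [outerRadius_map_add_smul]
  gcongr
  exact h₂ y hy

/-- If `T'` is close to `T`, then the hulls are close and the outer radii are uniformly close, so
the centre of `T'` is close to a point of the hull of `T` that nearly minimises the outer radius of
`T`. By compactness and uniqueness of the minimiser, such a point is close to the centre of `T`. -/
theorem continuousAt_center {T : MetricExp V} (hT : T.toSet.Nonempty) :
    ContinuousAt (center : MetricExp V → V) T := by
  obtain ⟨h₁, h₂⟩ := isCenter_center hT
  refine Metric.tendsto_nhds.2 fun ε hε => ?_
  -- Points of the hull far from the centre have outer radius at least `η` above the minimum.
  obtain ⟨η, hη, hgap⟩ : ∃ η : ℝ≥0, 0 < η ∧ ∀ x ∈ convexHull ℝ T.toSet,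
      T.outerRadius x < T.outerRadius T.center + η → dist x T.center < ε / 2 := by
    have hK : IsCompact (convexHull ℝ T.toSet \ ball T.center (ε / 2)) :=
      (T.finite_toSet.isCompact_convexHull ℝ).diff isOpen_ball
    rcases Set.eq_empty_or_nonempty (convexHull ℝ T.toSet \ ball T.center (ε / 2)) with h | h
    · exact ⟨1, one_pos, fun x hx _ => Set.sdiff_eq_empty.1 h hx⟩
    · obtain ⟨z, ⟨hz, hzb⟩, hmin⟩ := hK.exists_isMinOn h T.continuous_outerRadius_left.continuousOn
      have hlt : T.outerRadius T.center < T.outerRadius z := by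
        refine lt_of_le_of_ne (h₂ z hz) fun heq => hzb ?_
        have : T.IsCenter z := ⟨hz, fun y hy => heq ▸ h₂ y hy⟩
        rw [this.center_eq]
        exact mem_ball_self (half_pos hε)
      refine ⟨T.outerRadius z - T.outerRadius T.center, tsub_pos_of_lt hlt, fun x hx hxz => ?_⟩
      rw [add_tsub_cancel_of_le hlt.le] at hxz
      by_contra hxb
      exact (hmin ⟨hx, hxb⟩).not_gt hxz
  -- The estimates `e₁` to `e₅` below lose one `δ` each, except for the comparison `e₃` of minima.
  obtain ⟨δ, hδ, hδη, hδε⟩ : ∃ δ : ℝ≥0, 0 < δ ∧ 4 * δ < η ∧ (δ : ℝ) < ε / 2 := by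
    lift ε to ℝ≥0 using hε.le
    refine ⟨min (η / 5) (ε / 3), lt_min (by positivity) (div_pos (by exact_mod_cast hε)
      (by norm_num)), ?_, ?_⟩
    · refine (mul_le_mul_right (min_le_left _ _) 4).trans_lt ?_
      rw [← NNReal.coe_lt_coe] at hη ⊢
      push_cast at hη ⊢
      linarith
    · refine (NNReal.coe_le_coe.2 (min_le_right _ _)).trans_lt ?_
      push_cast
      linarith
  filter_upwards [T.eventually_subset_thickening (δ := δ) (by exact_mod_cast hδ)]
    with T' ⟨hT'T, hTT'⟩
  have hT' : T'.toSet.Nonempty := by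
    obtain ⟨t, ht⟩ := hT
    obtain ⟨t', ht', -⟩ := mem_thickening_iff.1 (hTT' ht)
    exact ⟨t', ht'⟩
  obtain ⟨h₁', h₂'⟩ := isCenter_center hT'
  have hull : ∀ {A B : Set V}, A ⊆ thickening δ B →
      convexHull ℝ A ⊆ thickening δ (convexHull ℝ B) := fun h =>
    convexHull_min (h.trans (thickening_subset_of_subset _ (subset_convexHull ℝ _)))
      ((convex_convexHull ℝ _).thickening _)
  obtain ⟨x, hx, hxd⟩ := mem_thickening_iff.1 (hull hT'T h₁')
  obtain ⟨y, hy, hyd⟩ := mem_thickening_iff.1 (hull hTT' h₁)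
  have e₁ := T.outerRadius_le_add_nndist x T'.center
  have e₂ := outerRadius_le_add_of_subset_thickening hTT' T'.center
  have e₃ := h₂' y hy
  have e₄ := T'.outerRadius_le_add_nndist y T.center
  have e₅ := outerRadius_le_add_of_subset_thickening hT'T T.center
  have hxc : dist x T.center < ε / 2 := by
    refine hgap x hx ?_
    rw [nndist_comm] at e₁ e₄
    simp only [← NNReal.coe_le_coe, ← NNReal.coe_lt_coe, NNReal.coe_add, coe_nndist,
      NNReal.coe_mul, NNReal.coe_ofNat] at *
    linarith
  linarith [dist_triangle T'.center x T.center]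

end MetricExp

/-! ### Neighbourhoods in the open cone -/

namespace OpenCone

variable {L : Type*}

/-- The radial coordinate on the open cone, equal to `0` at the tip. -/
def height : OpenCone L → ℝ
  | .tip => 0
  | .ray t _ => t

/-- The second coordinate on the open cone, followed by a map `f`, with a prescribed value at the
tip. -/
def shape {Y : Type*} (f : L → Y) (y₀ : Y) : OpenCone L → Y
  | .tip => y₀
  | .ray _ y => f y

variable [TopologicalSpace L]

theorem isOpen_iff {W : Set (OpenCone L)} : IsOpen W ↔
    IsOpen {z : Set.Ioi (0 : ℝ) × L | ray z.1 z.2 ∈ W} ∧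
      (tip ∈ W → ∃ ε : ℝ, 0 < ε ∧ ∀ (t : Set.Ioi (0 : ℝ)) (y : L), (t : ℝ) < ε → ray t y ∈ W) :=
  Iff.rfl

theorem isOpenEmbedding_ray :
    IsOpenEmbedding fun z : Set.Ioi (0 : ℝ) × L => ray z.1 z.2 := by
  have hinj : Function.Injective fun z : Set.Ioi (0 : ℝ) × L => ray z.1 z.2 := by
    rintro ⟨t, y⟩ ⟨t', y'⟩ h
    simpa using h
  refine .of_continuous_injective_isOpenMap
    (continuous_def.2 fun W hW => (isOpen_iff.1 hW).1) hinj fun O hO => isOpen_iff.2 ⟨?_, ?_⟩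
  · convert hO
    exact Set.preimage_image_eq O hinj
  · rintro ⟨z, -, hz⟩
    cases hz

theorem continuous_height : Continuous (height : OpenCone L → ℝ) := by
  refine continuous_def.2 fun W hW => isOpen_iff.2 ⟨?_, fun h => ?_⟩
  · exact hW.preimage (continuous_subtype_val.comp continuous_fst)
  · obtain ⟨ε, hε, hW'⟩ := Metric.isOpen_iff.1 hW 0 h
    refine ⟨ε, hε, fun t y ht => hW' ?_⟩
    rw [Metric.mem_ball, dist_zero_right, Real.norm_of_nonneg]
    · exact ht
    · exact t.2.le

/-- Points of the cone tend to the tip as soon as their heights tend to `0`, whatever happens in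
the possibly noncompact link. -/
theorem tendsto_nhds_tip {α : Type*} {l : Filter α} {w : α → OpenCone L}
    (h : Tendsto (fun a => (w a).height) l (𝓝 0)) : Tendsto w l (𝓝 tip) := by
  intro W hW
  obtain ⟨W', hW'W, hW', htip⟩ := mem_nhds_iff.1 hW
  obtain ⟨ε, hε, hray⟩ := (isOpen_iff.1 hW').2 htip
  change ∀ᶠ a in l, w a ∈ W
  filter_upwards [h.eventually (Iio_mem_nhds hε)] with a ha
  refine hW'W ?_
  have ha' : (w a).height < ε := ha
  change w a ∈ W'
  generalize w a = x at ha'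
  cases x with
  | tip => exact htip
  | ray t y => exact hray t y ha'

theorem tendsto_nhds_ray {Y : Type*} [TopologicalSpace Y] {f : L → Y} (hf : IsInducing f) (y₀ : Y)
    {α : Type*} {l : Filter α} {w : α → OpenCone L} {t : Set.Ioi (0 : ℝ)} {y : L}
    (h : Tendsto (fun a => (w a).height) l (𝓝 t))
    (h' : Tendsto (fun a => (w a).shape f y₀) l (𝓝 (f y))) : Tendsto w l (𝓝 (ray t y)) := by
  intro W hW
  have hW' : (fun z : Set.Ioi (0 : ℝ) × L => ray z.1 z.2) ⁻¹' W ∈ 𝓝 (t, y) :=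
    isOpenEmbedding_ray.continuous.continuousAt hW
  rw [nhds_prod_eq, nhds_subtype_eq_comap, hf.nhds_eq_comap, prod_comap_comap_eq] at hW'
  obtain ⟨N, hN, hNW⟩ := mem_comap.1 hW'
  change ∀ᶠ a in l, w a ∈ W
  filter_upwards [(h.prodMk h').eventually hN, h.eventually (Ioi_mem_nhds t.2)] with a ha ha₀
  have ha₁ : ((w a).height, (w a).shape f y₀) ∈ N := ha
  have ha₂ : 0 < (w a).height := ha₀
  generalize w a = x at ha₁ ha₂
  cases x with
  | tip => exact (lt_irrefl _ ha₂).elim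
  | ray s z => exact hNW (show (s, z) ∈ _ from ha₁)

end OpenCone

/-! ### Finite subsets of a disjoint union of normed spaces -/

namespace MetricExp

open scoped NNReal

variable {ι : Type*} {V : ι → Type*}

/-- The part of a finite subset of a disjoint union in one of the components. -/
noncomputable def fiber (T : MetricExp (Σ i, V i)) (i : ι) : MetricExp (V i) :=
  T.comap (Sigma.mk i) sigma_mk_injective

theorem mem_fiber {T : MetricExp (Σ i, V i)} {i : ι} {v : V i} :
    v ∈ (T.fiber i).toSet ↔ (⟨i, v⟩ : Σ i, V i) ∈ T.toSet := by
  simp [fiber]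

/-- A finite subset of a disjoint union is full when it meets every component. -/
def IsFull (T : MetricExp (Σ i, V i)) : Prop :=
  ∀ i, (T.fiber i).toSet.Nonempty

/-- The finite subset of a disjoint union having one given point in each component. -/
noncomputable def transversal [Finite ι] (u : ∀ i, V i) : MetricExp (Σ i, V i) :=
  ofSet (Set.range fun i => ⟨i, u i⟩) (Set.finite_range _)

theorem toSet_transversal [Finite ι] (u : ∀ i, V i) :
    (transversal u).toSet = Set.range fun i => (⟨i, u i⟩ : Σ i, V i) :=
  toSet_ofSet _ _

theorem toSet_fiber_transversal [Finite ι] (u : ∀ i, V i) (i : ι) :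
    ((transversal u).fiber i).toSet = {u i} := by
  ext v
  rw [mem_fiber, toSet_transversal]
  constructor
  · rintro ⟨i', h⟩
    obtain rfl : i' = i := congrArg Sigma.fst h
    exact (sigma_mk_injective h).symm
  · rintro rfl
    exact ⟨i, rfl⟩

theorem isFull_transversal [Finite ι] (u : ∀ i, V i) : (transversal u).IsFull := fun i => by
  simp [toSet_fiber_transversal]

theorem count_transversal [Finite ι] (u : ∀ i, V i) : (transversal u).count = ⟨Nat.card ι⟩ := by
  rw [count_eq_ncard, toSet_transversal,
    Set.ncard_range_of_injective fun i i' h => congrArg Sigma.fst h]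

variable [∀ i, NormedAddCommGroup (V i)]

theorem continuous_fiber (i : ι) :
    Continuous fun T : MetricExp (Σ i, V i) => T.fiber i :=
  continuous_comap .sigmaMk .sigmaMk

theorem isOpen_setOf_isFull [Finite ι] : IsOpen {T : MetricExp (Σ i, V i) | T.IsFull} := by
  have : {T : MetricExp (Σ i, V i) | T.IsFull} =
      ⋂ i, (fun T => T.fiber i) ⁻¹' {S | (S.toSet ∩ Set.univ).Nonempty} := by
    ext T
    simp [IsFull]
  rw [this]
  exact isOpen_iInter_of_finite fun i =>
    (isOpen_setOf_toSet_inter_nonempty isOpen_univ).preimage (continuous_fiber i)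

variable [∀ i, NormedSpace ℝ (V i)]

/-- The map acting on the component `V i` of a disjoint union by `v ↦ u i + t • v`. -/
def homothety (u : ∀ i, V i) (t : ℝ) (z : Σ i, V i) : Σ i, V i :=
  ⟨z.1, u z.1 + t • z.2⟩

theorem homothety_injective (u : ∀ i, V i) {t : ℝ} (ht : t ≠ 0) :
    Function.Injective (homothety u t) := by
  rintro ⟨i, v⟩ ⟨i', v'⟩ h
  obtain rfl : i = i' := congrArg Sigma.fst h
  have := smul_right_injective _ ht (add_left_cancel (sigma_mk_injective h))
  exact congrArg _ this

theorem continuous_homothety :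
    Continuous fun z : ((∀ i, V i) × ℝ) × Σ i, V i => homothety z.1.1 z.1.2 z.2 := by
  refine continuous_iff_continuousAt.2 ?_
  rintro ⟨⟨u, t⟩, ⟨i, v⟩⟩
  have h : IsOpenEmbedding (Prod.map (id : (∀ i, V i) × ℝ → _) (Sigma.mk i : V i → Σ i, V i)) :=
    IsOpenEmbedding.id.prodMap .sigmaMk
  refine (h.continuousAt_iff (x := ((u, t), v))).1 (Continuous.continuousAt ?_)
  have : Continuous fun z : ((∀ i, V i) × ℝ) × V i => z.1.1 i + z.1.2 • z.2 := by fun_prop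
  exact continuous_sigmaMk.comp this

theorem map_homothety_map_homothety (u u' : ∀ i, V i) (t t' : ℝ) (T : MetricExp (Σ i, V i)) :
    (T.map (homothety u' t')).map (homothety u t) = T.map (homothety (u + t • u') (t * t')) := by
  rw [map_map]
  congr 1
  funext ⟨i, v⟩
  refine congrArg (Sigma.mk i) ?_
  change u i + t • (u' i + t' • v) = (u i + t • u' i) + (t * t') • v
  module

theorem map_homothety_zero_one (T : MetricExp (Σ i, V i)) : T.map (homothety 0 1) = T :=
  toSet_injective (by simp [homothety, Set.image_congr'])

theorem fiber_map_homothety (u : ∀ i, V i) (t : ℝ) (T : MetricExp (Σ i, V i)) (i : ι) :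
    (T.map (homothety u t)).fiber i = (T.fiber i).map fun v => u i + t • v := by
  refine toSet_injective (Set.ext fun v => ?_)
  rw [mem_fiber, toSet_map, toSet_map]
  constructor
  · rintro ⟨⟨i', v'⟩, hz, h⟩
    obtain rfl : i' = i := congrArg Sigma.fst h
    exact ⟨v', mem_fiber.2 hz, sigma_mk_injective h⟩
  · rintro ⟨v', hv', rfl⟩
    exact ⟨⟨i, v'⟩, mem_fiber.1 hv', rfl⟩

theorem IsFull.map_homothety {T : MetricExp (Σ i, V i)} (hT : T.IsFull) (u : ∀ i, V i) (t : ℝ) :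
    (T.map (homothety u t)).IsFull := fun i => by
  rw [fiber_map_homothety, toSet_map]
  exact (hT i).image _

/-- The Chebyshev centres of the parts of a finite subset of a disjoint union. -/
noncomputable def centers (T : MetricExp (Σ i, V i)) (i : ι) : V i :=
  (T.fiber i).center

section Centers

variable [∀ i, StrictConvexSpace ℝ (V i)]

theorem centers_eq_of_toSet_fiber {T : MetricExp (Σ i, V i)} {i : ι} {v : V i}
    (h : (T.fiber i).toSet = {v}) : T.centers i = v :=
  IsCenter.center_eq ⟨by simp [h], fun y hy => by simp_all⟩

theorem centers_map_homothety {T : MetricExp (Σ i, V i)} (hT : T.IsFull) (u : ∀ i, V i) (t : ℝ) :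
    (T.map (homothety u t)).centers = u + t • T.centers := by
  funext i
  rw [centers, fiber_map_homothety, center_map_add_smul (hT i)]
  rfl

theorem continuousAt_centers {T : MetricExp (Σ i, V i)} (hT : T.IsFull) :
    ContinuousAt (centers : MetricExp (Σ i, V i) → ∀ i, V i) T :=
  continuousAt_pi.2 fun i =>
    (continuousAt_center (hT i)).comp' (continuous_fiber i).continuousAt

theorem centers_transversal [Finite ι] (u : ∀ i, V i) : (transversal u).centers = u :=
  funext fun i => centers_eq_of_toSet_fiber (toSet_fiber_transversal u i)

end Centers

variable [Fintype ι]

/-- The largest distance from a point of a finite subset of a disjoint union to the centre of the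
part containing it. -/
noncomputable def radius (T : MetricExp (Σ i, V i)) : ℝ :=
  (Finset.univ.sup fun i => (T.fiber i).outerRadius (T.centers i) : ℝ≥0)

theorem radius_nonneg (T : MetricExp (Σ i, V i)) : 0 ≤ T.radius :=
  NNReal.coe_nonneg _

theorem dist_centers_le_radius {T : MetricExp (Σ i, V i)} {z : Σ i, V i} (hz : z ∈ T.toSet) :
    dist (T.centers z.1) z.2 ≤ T.radius :=
  (nndist_le_outerRadius (mem_fiber.2 hz) (T.centers z.1)).trans
    (Finset.le_sup (f := fun i => (T.fiber i).outerRadius (T.centers i)) (Finset.mem_univ z.1))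

theorem radius_eq_zero_iff {T : MetricExp (Σ i, V i)} :
    T.radius = 0 ↔ ∀ z ∈ T.toSet, T.centers z.1 = z.2 := by
  constructor
  · exact fun h z hz => dist_le_zero.1 (h ▸ dist_centers_le_radius hz)
  · intro h
    rw [radius, NNReal.coe_eq_zero, ← bot_eq_zero, Finset.sup_eq_bot_iff]
    refine fun i _ => le_bot_iff.1 (outerRadius_le_iff.2 fun v hv => ?_)
    rw [h _ (mem_fiber.1 hv), nndist_self, bot_eq_zero]

theorem IsFull.eq_transversal {T : MetricExp (Σ i, V i)} (hT : T.IsFull) (h : T.radius = 0) :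
    T = transversal T.centers := by
  rw [radius_eq_zero_iff] at h
  refine toSet_injective (Set.ext fun z => ?_)
  rw [toSet_transversal]
  constructor
  · exact fun hz => ⟨z.1, by simp only [h z hz]⟩
  · rintro ⟨i, rfl⟩
    obtain ⟨v, hv⟩ := hT i
    rw [mem_fiber] at hv
    have := h _ hv
    dsimp only at this ⊢
    rwa [this]

theorem radius_transversal [∀ i, StrictConvexSpace ℝ (V i)] (u : ∀ i, V i) :
    (transversal u).radius = 0 := by
  rw [radius_eq_zero_iff, centers_transversal, toSet_transversal]
  rintro _ ⟨i, rfl⟩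
  rfl

theorem radius_map_homothety [∀ i, StrictConvexSpace ℝ (V i)] {T : MetricExp (Σ i, V i)}
    (hT : T.IsFull) (u : ∀ i, V i) {t : ℝ} (ht : 0 ≤ t) :
    (T.map (homothety u t)).radius = t * T.radius := by
  have h : ∀ i, ((T.map (homothety u t)).fiber i).outerRadius
      ((T.map (homothety u t)).centers i) = ‖t‖₊ * (T.fiber i).outerRadius (T.centers i) :=
    fun i => by
      rw [centers_map_homothety hT, fiber_map_homothety]
      exact outerRadius_map_add_smul _ _ _ _
  simp only [radius, h]
  rw [← NNReal.mul_finset_sup, NNReal.coe_mul, coe_nnnorm, Real.norm_of_nonneg ht]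

theorem continuousAt_radius [∀ i, StrictConvexSpace ℝ (V i)] {T : MetricExp (Σ i, V i)}
    (hT : T.IsFull) :
    ContinuousAt (radius : MetricExp (Σ i, V i) → ℝ) T := by
  have h : ∀ i ∈ (Finset.univ : Finset ι), ContinuousAt
      (fun T : MetricExp (Σ i, V i) => (T.fiber i).outerRadius (T.centers i)) T := fun i _ =>
    continuous_outerRadius.continuousAt.comp' (x := T)
      ((continuous_fiber i).continuousAt.prodMk (continuousAt_pi.1 (continuousAt_centers hT) i))
  exact NNReal.continuous_coe.continuousAt.comp' (ContinuousAt.finset_sup_apply h)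

/-- A full finite subset with only one point in each component has radius `0`, so a full finite
subset of nonzero radius has more points than there are components. -/
theorem IsFull.card_lt_ncard [∀ i, StrictConvexSpace ℝ (V i)] {T : MetricExp (Σ i, V i)}
    (hT : T.IsFull) (h : T.radius ≠ 0) :
    Nat.card ι < T.toSet.ncard := by
  have himage : Sigma.fst '' T.toSet = Set.univ := Set.eq_univ_of_forall fun i => by
    obtain ⟨v, hv⟩ := hT i
    exact ⟨_, mem_fiber.1 hv, rfl⟩
  rw [← Set.ncard_univ, ← himage]
  refine lt_of_le_of_ne (Set.ncard_image_le T.finite_toSet) fun heq => h ?_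
  have hinj : Set.InjOn Sigma.fst T.toSet := Set.injOn_of_ncard_image_eq heq T.finite_toSet
  refine radius_eq_zero_iff.2 fun z hz => centers_eq_of_toSet_fiber (Set.ext fun v => ?_)
  rw [mem_fiber, Set.mem_singleton_iff]
  constructor
  · exact fun hv => sigma_mk_injective (hinj hv hz rfl)
  · rintro rfl
    exact hz

/-! ### The conical structure -/

/-- The link of the locus of transversals: the full finite subsets with centres `0` and
radius `1`. -/
def IsNormalized (T : MetricExp (Σ i, V i)) : Prop :=
  T.IsFull ∧ T.centers = 0 ∧ T.radius = 1

/-- Translate the centres to `0` and rescale the radius to `1`. This is meaningful only for nonzero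
radius, since the inverse of `0` is `0`. -/
noncomputable def normalize (T : MetricExp (Σ i, V i)) : MetricExp (Σ i, V i) :=
  T.map (homothety (-(T.radius⁻¹ • T.centers)) T.radius⁻¹)

theorem map_homothety_normalize {T : MetricExp (Σ i, V i)} (h : T.radius ≠ 0) :
    T.normalize.map (homothety T.centers T.radius) = T := by
  rw [normalize, map_homothety_map_homothety, smul_neg, smul_inv_smul₀ h, mul_inv_cancel₀ h,
    add_neg_cancel, map_homothety_zero_one]

variable {L : Type*}

/-- The map sending `u` and the cone point `(t, y)` to the finite subset obtained from `f y` by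
scaling by `t` and translating by `u`, and sending `u` and the tip to the transversal `u`. -/
noncomputable def spread (f : L → MetricExp (Σ i, V i)) (z : (∀ i, V i) × OpenCone L) :
    MetricExp (Σ i, V i) :=
  match z.2 with
  | .tip => transversal z.1
  | .ray t y => (f y).map (homothety z.1 t)

theorem isFull_spread {f : L → MetricExp (Σ i, V i)}
    (hf : ∀ y, (f y).IsNormalized) (z : (∀ i, V i) × OpenCone L) : (spread f z).IsFull := by
  obtain ⟨u, _ | ⟨t, y⟩⟩ := z
  · exact isFull_transversal u
  · exact (hf y).1.map_homothety u t

variable [∀ i, StrictConvexSpace ℝ (V i)]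

theorem isNormalized_normalize {T : MetricExp (Σ i, V i)} (hT : T.IsFull) (h : T.radius ≠ 0) :
    T.normalize.IsNormalized := by
  refine ⟨hT.map_homothety _ _, ?_, ?_⟩
  · rw [normalize, centers_map_homothety hT, neg_add_cancel]
  · rw [normalize, radius_map_homothety hT _ (inv_nonneg.2 T.radius_nonneg), inv_mul_cancel₀ h]

theorem IsNormalized.normalize_map_homothety {T : MetricExp (Σ i, V i)} (hT : T.IsNormalized)
    (u : ∀ i, V i) {t : ℝ} (ht : 0 < t) : (T.map (homothety u t)).normalize = T := by
  rw [normalize, centers_map_homothety hT.1, radius_map_homothety hT.1 _ ht.le, hT.2.1, hT.2.2,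
    map_homothety_map_homothety, smul_zero, add_zero, mul_one, neg_add_cancel,
    inv_mul_cancel₀ ht.ne', map_homothety_zero_one]

theorem continuousAt_normalize {T : MetricExp (Σ i, V i)} (hT : T.IsFull) (h : T.radius ≠ 0) :
    ContinuousAt (normalize : MetricExp (Σ i, V i) → MetricExp (Σ i, V i)) T := by
  have hr := (continuousAt_radius hT).inv₀ h
  exact tendsto_map (f := fun a : (∀ i, V i) × ℝ => homothety a.1 a.2) continuous_homothety
    (((hr.smul (continuousAt_centers hT)).neg).prodMk hr) tendsto_id

variable {f : L → MetricExp (Σ i, V i)}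

theorem centers_spread (hf : ∀ y, (f y).IsNormalized)
    (z : (∀ i, V i) × OpenCone L) : (spread f z).centers = z.1 := by
  obtain ⟨u, _ | ⟨t, y⟩⟩ := z
  · exact centers_transversal u
  · simp [spread, centers_map_homothety (hf y).1, (hf y).2.1]

theorem radius_spread (hf : ∀ y, (f y).IsNormalized)
    (z : (∀ i, V i) × OpenCone L) : (spread f z).radius = z.2.height := by
  obtain ⟨u, _ | ⟨t, y⟩⟩ := z
  · exact radius_transversal u
  · simp [spread, OpenCone.height, radius_map_homothety (hf y).1 u t.2.le, (hf y).2.2]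

theorem normalize_spread_ray (hf : ∀ y, (f y).IsNormalized)
    (u : ∀ i, V i) (t : Set.Ioi (0 : ℝ)) (y : L) :
    (spread f (u, .ray t y)).normalize = f y :=
  (hf y).normalize_map_homothety u t.2

theorem spread_injective (hf : ∀ y, (f y).IsNormalized)
    (hinj : Function.Injective f) : Function.Injective (spread f) := by
  intro z z' h
  have h₁ : z.1 = z'.1 := by rw [← centers_spread hf, h, centers_spread hf]
  have h₂ : z.2.height = z'.2.height := by rw [← radius_spread hf, h, radius_spread hf]
  obtain ⟨u, _ | ⟨t, y⟩⟩ := z <;> obtain ⟨u', _ | ⟨t', y'⟩⟩ := z'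
  · exact congrArg (·, _) h₁
  · exact (t'.2.ne h₂).elim
  · exact (t.2.ne' h₂).elim
  · have h₃ : y = y' := hinj <| by
      rw [← normalize_spread_ray hf u t y, h, normalize_spread_ray hf]
    obtain rfl : u = u' := h₁
    rw [Subtype.ext (a1 := t) (a2 := t') h₂, h₃]

theorem range_spread (hf : ∀ y, (f y).IsNormalized)
    (hrange : ∀ T, T.IsNormalized → T ∈ Set.range f) :
    Set.range (spread f) = {T | T.IsFull} := by
  refine Set.Subset.antisymm (Set.range_subset_iff.2 (isFull_spread hf)) fun T hT => ?_
  rcases eq_or_ne T.radius 0 with h | h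
  · exact ⟨(T.centers, .tip), (IsFull.eq_transversal hT h).symm⟩
  · obtain ⟨y, hy⟩ := hrange _ (isNormalized_normalize hT h)
    refine ⟨(T.centers, .ray ⟨T.radius, T.radius_nonneg.lt_of_ne' h⟩ y), ?_⟩
    simp only [spread, hy]
    exact map_homothety_normalize h

variable [TopologicalSpace L]

theorem continuous_spread (hf : ∀ y, (f y).IsNormalized)
    (hcont : Continuous f) : Continuous (spread f) := by
  refine continuous_iff_continuousAt.2 ?_
  rintro ⟨u, _ | ⟨t, y⟩⟩
  · -- Every point of `spread f z` in `V i` is within the height of `z.2` of `z.1 i`.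
    have key : ∀ i, ∀ O ∈ 𝓝 (u i), ∀ᶠ z in 𝓝 (u, (OpenCone.tip : OpenCone L)),
        ∀ v ∈ ((spread f z).fiber i).toSet, v ∈ O := by
      intro i O hO
      obtain ⟨ε, hε, hεO⟩ := Metric.mem_nhds_iff.1 hO
      have h₁ : ContinuousAt (fun z : (∀ i, V i) × OpenCone L => dist (z.1 i) (u i) + z.2.height)
          (u, .tip) := by
        have := OpenCone.continuous_height (L := L)
        fun_prop
      have h₂ := h₁.eventually_lt_const (show dist (u i) (u i) + 0 < ε by simpa)
      filter_upwards [h₂] with z hz v hv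
      refine hεO (Metric.mem_ball.2 ?_)
      have h₃ := dist_centers_le_radius (mem_fiber.1 hv)
      rw [centers_spread hf, radius_spread hf] at h₃
      linarith [dist_triangle_left v (u i) (z.1 i)]
    refine tendsto_nhds_iff.2 fun O hO => ⟨fun hS => ?_, ?_⟩
    · have hS' : ∀ i, (Sigma.mk i) ⁻¹' O ∈ 𝓝 (u i) := fun i =>
        (hO.preimage continuous_sigmaMk).mem_nhds
          (hS (show (⟨i, u i⟩ : Σ i, V i) ∈ (transversal u).toSet by simp [toSet_transversal]))
      filter_upwards [eventually_all.2 fun i => key i _ (hS' i)] with z hz x hx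
      exact hz x.1 x.2 (mem_fiber.2 hx)
    · rintro ⟨x, hx, hxO⟩
      have hx' : x ∈ (transversal u).toSet := hx
      rw [toSet_transversal] at hx'
      obtain ⟨i, rfl⟩ := hx'
      filter_upwards [key i _ ((hO.preimage continuous_sigmaMk).mem_nhds hxO)] with z hz
      obtain ⟨v, hv⟩ := isFull_spread hf z i
      exact ⟨_, mem_fiber.1 hv, hz v hv⟩
  · have h : IsOpenEmbedding (Prod.map (id : (∀ i, V i) → _)
        fun z : Set.Ioi (0 : ℝ) × L => OpenCone.ray z.1 z.2) :=
      IsOpenEmbedding.id.prodMap OpenCone.isOpenEmbedding_ray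
    refine (h.continuousAt_iff (x := (u, (t, y)))).1 ?_
    refine tendsto_map (f := fun a : (∀ i, V i) × ℝ => homothety a.1 a.2) continuous_homothety
      (a := fun z : (∀ i, V i) × Set.Ioi (0 : ℝ) × L => (z.1, (z.2.1 : ℝ)))
      (F := fun z => f z.2.2) (Continuous.tendsto (by fun_prop) (u, (t, y)))
      (Continuous.tendsto (by fun_prop) (u, (t, y)))

theorem isOpenEmbedding_spread (hf : ∀ y, (f y).IsNormalized)
    (hemb : IsEmbedding f)
    (hrange : ∀ T, T.IsNormalized → T ∈ Set.range f) : IsOpenEmbedding (spread f) where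
  injective := spread_injective hf hemb.injective
  isOpen_range := range_spread hf hrange ▸ isOpen_setOf_isFull
  eq_induced := by
    suffices h : IsInducing (spread f) from h.eq_induced
    refine isInducing_iff_nhds.2 fun z =>
      le_antisymm (tendsto_iff_comap.1 (continuous_spread hf hemb.continuous).continuousAt) ?_
    -- The coordinates of a cone point are recovered from centres, radius and normalisation.
    have hT := isFull_spread hf z
    have ht := tendsto_comap (f := spread f) (x := 𝓝 (spread f z))
    have h₁ := (continuousAt_centers hT).tendsto.comp ht
    have h₂ := (continuousAt_radius hT).tendsto.comp ht
    simp only [Function.comp_def, centers_spread hf, radius_spread hf] at h₁ h₂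
    refine tendsto_id'.1 (Tendsto.prodMk_nhds (x := z.1) (y := z.2) h₁ ?_)
    obtain ⟨u, _ | ⟨t, y⟩⟩ := z
    · exact OpenCone.tendsto_nhds_tip h₂
    · refine OpenCone.tendsto_nhds_ray hemb.isInducing (f y) h₂ ?_
      have hr : (spread f (u, .ray t y)).radius ≠ 0 := by
        rw [radius_spread hf]
        exact t.2.ne'
      have h₃ := (continuousAt_normalize hT hr).tendsto.comp ht
      rw [normalize_spread_ray hf] at h₃
      refine h₃.congr' ?_
      filter_upwards [h₂.eventually (Ioi_mem_nhds t.2)] with z hz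
      obtain ⟨u', _ | ⟨t', y'⟩⟩ := z
      · exact (lt_irrefl _ hz).elim
      · exact normalize_spread_ray hf u' t' y'

end MetricExp

/-! ### Charts of locally rotund spaces -/

/-- The topology of a rotund vector space comes from a strictly convex normed space structure. -/
theorem IsRotund.exists_strictConvexSpace {V : Type v} [AddCommGroup V] [Module ℝ V]
    [t : TopologicalSpace V] (hV : IsRotund V) :
    ∃ (_ : NormedAddCommGroup V) (_ : NormedSpace ℝ V),
      StrictConvexSpace ℝ V ∧ t = UniformSpace.toTopologicalSpace := by
  obtain ⟨N, h₀, hopen, hrot⟩ := hV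
  let norm : NormedAddCommGroup V := AddGroupNorm.toNormedAddCommGroup
    { N.toAddGroupSeminorm with eq_zero_of_map_eq_zero' := h₀ }
  let space : NormedSpace ℝ V := { norm_smul_le := fun a x => (map_smul_eq_mul N a x).le }
  refine ⟨norm, space, StrictConvexSpace.of_norm_add_ne_two fun x y hx hy hne h => hne ?_, ?_⟩
  · refine hrot x y (hx.trans hy.symm) (hy.trans ?_)
    change 1 = ‖(2⁻¹ : ℝ) • (x + y)‖
    rw [norm_smul, h]
    norm_num
  · refine TopologicalSpace.ext_iff.2 fun W => (hopen W).trans ?_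
    rw [Metric.isOpen_iff]
    simp only [Set.subset_def, Metric.mem_ball, dist_eq_norm]
    rfl

/-- A small ball in a chart is homeomorphic to the whole model space, which gives arbitrarily small
charts without boundary conditions on the model side. -/
theorem IsLocallyRotund.exists_isOpenEmbedding {X : Type u} [TopologicalSpace X]
    (hX : IsLocallyRotund.{u, v} X) (x : X) {W : Set X} (hW : W ∈ 𝓝 x) :
    ∃ (V : Type v) (_ : NormedAddCommGroup V) (_ : NormedSpace ℝ V) (_ : StrictConvexSpace ℝ V)
      (j : V → X), IsOpenEmbedding j ∧ j 0 = x ∧ Set.range j ⊆ W := by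
  obtain ⟨V, _, _, t, e, hV, hx⟩ := hX x
  obtain ⟨_, _, hconv, rfl⟩ := hV.exists_strictConvexSpace
  have hx' : e.target ∩ e.symm ⁻¹' interior W ∈ 𝓝 (e x) :=
    (e.isOpen_inter_preimage_symm isOpen_interior).mem_nhds
      ⟨e.map_source hx, by simpa [e.left_inv hx, mem_interior_iff_mem_nhds] using hW⟩
  obtain ⟨r, hr, hball⟩ := Metric.mem_nhds_iff.1 hx'
  have htarget : (OpenPartialHomeomorph.univBall (e x) r).target = Metric.ball (e x) r :=
    OpenPartialHomeomorph.univBall_target _ hr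
  have hmem : ∀ v, OpenPartialHomeomorph.univBall (e x) r v ∈ e.target ∩ e.symm ⁻¹' interior W :=
    fun v => hball (htarget ▸ OpenPartialHomeomorph.map_source _ (by simp))
  refine ⟨V, _, _, hconv, (OpenPartialHomeomorph.univBall (e x) r).trans e.symm,
    OpenPartialHomeomorph.isOpenEmbedding _ ?_, ?_, ?_⟩
  · ext v
    simpa using (hmem v).1
  · simp [e.left_inv hx]
  · rintro _ ⟨v, rfl⟩
    exact interior_subset (hmem v).2

/-- Charts at finitely many points of a Hausdorff space can be made disjoint, and then combine to
an open embedding of the disjoint union of the model spaces. -/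
theorem IsLocallyRotund.exists_isOpenEmbedding_sigma {X : Type u} [TopologicalSpace X] [T2Space X]
    (hX : IsLocallyRotund.{u, v} X) {s : Set X} (hs : s.Finite) :
    ∃ (V : s → Type v) (_ : ∀ i, NormedAddCommGroup (V i)) (_ : ∀ i, NormedSpace ℝ (V i))
      (_ : ∀ i, StrictConvexSpace ℝ (V i)) (j : (Σ i, V i) → X),
      IsOpenEmbedding j ∧ ∀ i, j ⟨i, 0⟩ = i := by
  obtain ⟨W, hW, hdisj⟩ := hs.t2_separation
  choose V h₁ h₂ h₃ j hj hj₀ hjW using fun i : s =>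
    hX.exists_isOpenEmbedding i.1 ((hW i).2.mem_nhds (hW i).1)
  refine ⟨V, h₁, h₂, h₃, fun z => j z.1 z.2, ?_, hj₀⟩
  refine .of_continuous_injective_isOpenMap (continuous_sigma fun i => (hj i).continuous) ?_
    (isOpenMap_sigma.2 fun i => (hj i).isOpenMap)
  rintro ⟨i, v⟩ ⟨i', v'⟩ h
  have hv : j i v ∈ W i := hjW i ⟨v, rfl⟩
  have hv' : j i v ∈ W i' := hjW i' ⟨v', h.symm⟩
  obtain rfl : i = i' := by
    by_contra hne
    exact Set.disjoint_left.1 (hdisj i.2 i'.2 fun h => hne (Subtype.ext h)) hv hv'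
  exact congrArg _ ((hj i).injective h)

/-! ### Conical charts of the metric exponential -/

namespace MetricExp

variable {X : Type u} {ι : Type*} [Fintype ι] {V : ι → Type v}
  [∀ i, NormedAddCommGroup (V i)] [∀ i, NormedSpace ℝ (V i)]

/-- The link of the conical charts, realised inside the metric exponential of `X` through the
injection `j`, so that its universe is that of `X`. -/
def link (j : (Σ i, V i) → X) : Set (MetricExp X) :=
  {S | ∃ T : MetricExp (Σ i, V i), T.IsNormalized ∧ T.map j = S}

/-- The normalised finite subset of the model space that corresponds to a point of the link. -/
noncomputable def linkModel (j : (Σ i, V i) → X) (y : link j) : MetricExp (Σ i, V i) :=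
  y.2.choose

theorem isNormalized_linkModel {j : (Σ i, V i) → X} (y : link j) : (linkModel j y).IsNormalized :=
  y.2.choose_spec.1

theorem map_linkModel {j : (Σ i, V i) → X} (y : link j) : (linkModel j y).map j = y.1 :=
  y.2.choose_spec.2

theorem mem_range_linkModel {j : (Σ i, V i) → X} (hj : Function.Injective j)
    (T : MetricExp (Σ i, V i)) (hT : T.IsNormalized) : T ∈ Set.range (linkModel j) :=
  ⟨⟨T.map j, T, hT, rfl⟩, map_injective hj (map_linkModel _)⟩

theorem isEmbedding_linkModel [TopologicalSpace X] {j : (Σ i, V i) → X} (hj : IsOpenEmbedding j) :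
    IsEmbedding (linkModel j) := by
  have hcomp : map j ∘ linkModel j = Subtype.val := funext map_linkModel
  have hmap := (isOpenEmbedding_map hj).isEmbedding
  refine .of_comp (hmap.isInducing.continuous_iff.2 ?_) hmap.continuous ?_
  · rw [hcomp]
    exact continuous_subtype_val
  · rw [hcomp]
    exact IsEmbedding.subtypeVal

/-- The transversals, as a family of points of a stratum of the metric exponential. -/
noncomputable def stratumChart {j : (Σ i, V i) → X} (hj : Function.Injective j) (u : ∀ i, V i) :
    {S : MetricExp X // S.count = ⟨Nat.card ι⟩} :=
  ⟨(transversal u).map j, (count_map hj _).trans (count_transversal u)⟩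

variable [∀ i, StrictConvexSpace ℝ (V i)]

/-- Every point of the link has more points than the model space has components. If there are no
components then the link is empty. -/
theorem lt_count_link {j : (Σ i, V i) → X} (hj : Function.Injective j) (y : link j) :
    (⟨Nat.card ι⟩ : OmegaStar) < y.1.count := by
  obtain ⟨hfull, -, hr⟩ := isNormalized_linkModel y
  have hlt := hfull.card_lt_ncard (hr ▸ one_ne_zero)
  rw [← map_linkModel y, count_map hj, count_eq_ncard]
  have hpos : 0 < Nat.card ι := by
    have : Nonempty ι := by
      by_contra h
      have := not_nonempty_iff.1 h
      simp [radius] at hr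
    exact Nat.card_pos
  exact lt_of_le_of_ne (Or.inr ⟨hpos, hlt.le⟩) fun h => hlt.ne (congrArg OmegaStar.val h)

variable [TopologicalSpace X]

theorem isOpenEmbedding_map_spread {j : (Σ i, V i) → X} (hj : IsOpenEmbedding j) :
    IsOpenEmbedding fun z => (spread (linkModel j) z).map j :=
  (isOpenEmbedding_map hj).comp
    (isOpenEmbedding_spread isNormalized_linkModel (isEmbedding_linkModel hj)
      (mem_range_linkModel hj.injective))

theorem isOpenEmbedding_stratumChart {j : (Σ i, V i) → X} (hj : IsOpenEmbedding j) :
    IsOpenEmbedding (stratumChart hj.injective) := by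
  have hemb : IsEmbedding fun u : ∀ i, V i => (transversal u).map j :=
    (isOpenEmbedding_map_spread hj).isEmbedding.comp
      (isEmbedding_prodMkLeft (OpenCone.tip : OpenCone (link j)))
  refine ⟨hemb.codRestrict {S : MetricExp X | S.count = ⟨Nat.card ι⟩} _, ?_⟩
  have hrange : Set.range (stratumChart hj.injective) =
      Subtype.val ⁻¹' (map j '' {T | T.IsFull}) := by
    ext S
    constructor
    · rintro ⟨u, rfl⟩
      exact ⟨_, isFull_transversal u, rfl⟩
    · rintro ⟨T, hT, hTS⟩
      refine ⟨T.centers, Subtype.ext ?_⟩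
      -- A full subset with one point for each component has radius `0`.
      have hr : T.radius = 0 := by
        by_contra hr
        have hc := S.2
        rw [← hTS, count_map hj.injective, count_eq_ncard] at hc
        exact (IsFull.card_lt_ncard hT hr).ne' (congrArg OmegaStar.val hc)
      rw [← hTS]
      exact congrArg (map j) (IsFull.eq_transversal hT hr).symm
  rw [hrange]
  exact ((isOpenEmbedding_map hj).isOpenMap _ isOpen_setOf_isFull).preimage continuous_subtype_val

end MetricExp

/-- The metric exponential of a Hausdorff space which is locally homeomorphic to rotund vector
spaces, stratified by cardinality, is conically stratified. -/
theorem theorem4p12 {X : Type u} [TopologicalSpace X] [T2Space X]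
    (hX : IsLocallyRotund.{u, v} X) :
    IsConicallyStratified (MetricExp.count : MetricExp X → OmegaStar) := by
  refine ⟨isStratification_iff_eventually_le.2 MetricExp.eventually_count_le, ?_⟩
  rintro p ⟨S, hp⟩
  have := S.finite_toSet.fintype
  obtain ⟨V, _, _, _, j, hj, hj₀⟩ := hX.exists_isOpenEmbedding_sigma S.finite_toSet
  obtain rfl : p = ⟨Nat.card S.toSet⟩ := hp.symm.trans S.count_eq_ncard
  have hs := MetricExp.isOpenEmbedding_stratumChart hj
  let h := hs.isEmbedding.toHomeomorph
  let e : Set.range (MetricExp.stratumChart hj.injective) × OpenCone (MetricExp.link j) →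
      MetricExp X := fun z => (MetricExp.spread (MetricExp.linkModel j) (h.symm z.1, z.2)).map j
  have htip : ∀ U, e (U, .tip) = U.1.1 := fun U =>
    congrArg (fun U : Set.range (MetricExp.stratumChart hj.injective) => U.1.1)
      (h.apply_symm_apply U)
  refine ⟨Set.range (MetricExp.stratumChart hj.injective), MetricExp.link j, inferInstance,
    fun y => ⟨y.1.count, MetricExp.lt_count_link hj.injective y⟩, e, hs.isOpen_range, ?_, ?_, ?_,
    htip, ?_⟩
  · refine ⟨0, Subtype.ext (MetricExp.toSet_injective ?_)⟩
    change ((MetricExp.transversal 0).map j).toSet = S.toSet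
    rw [MetricExp.toSet_map, MetricExp.toSet_transversal, ← Set.range_comp]
    simp [Function.comp_def, hj₀]
  · exact isStratification_iff_eventually_le.2 fun y =>
      continuous_subtype_val.continuousAt.eventually (MetricExp.eventually_count_le y.1)
  · exact (MetricExp.isOpenEmbedding_map_spread hj).comp
      (h.symm.isOpenEmbedding.prodMap .id)
  · rintro ⟨U, _ | ⟨t, y⟩⟩
    · rw [htip]
      exact U.1.2
    · change (((MetricExp.linkModel j y).map (MetricExp.homothety (h.symm U) t)).map j).count =
        y.1.count
      rw [MetricExp.count_map hj.injective,
        MetricExp.count_map (MetricExp.homothety_injective _ t.2.ne'),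
        ← MetricExp.map_linkModel y, MetricExp.count_map hj.injective]
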